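/- Let $k$ be an algebraically closed field and let $H$ be a Hopf algebra over $k$. Let $G$ be an abelian group of group-like elements of $H$ and let $a_1,\dots,a_t\in H$ (with $t\ge 0$) be skew-primitive with respect to $G$, that is, for every $i$ there are $g_i,h_i\in G$ with $\Delta(a_i)=g_i\otimes a_i+a_i\otimes h_i$. Assume that $H$ is generated as an algebra by $G$ and $a_1,\dots,a_t$, and that the $k$-linear span of $a_1,\dots,a_t$ is stable under the adjoint action $x\mapsto gxg^{-1}$ of every $g\in G$. Then $H$ has a PBW basis $(G,S,<,h)$: there are a subset $S\subset H$, a total order $<$ on $S$ and a height function $h:S\to\{1,2,3,\dots\}\cup\{\infty\}$ such that the products \[ s_1^{e_1}s_2^{e_2}\cdots s_r^{e_r}\,g,\qquad r\ge 0,\quad s_1>s_2>\dots>s_r \text{ in } S,\quad e_i\in\mathbb{Z},\ 0<e_i<h(s_i),\quad g\in G, \] are pairwise different (for different data $r,(s_i),(e_i),g$) and form a basis of the $k$-vector space $H$. -/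

import Mathlib

open scoped TensorProduct

noncomputable section

namespace PBW

/-- `a` is `(g, h)`-skew-primitive: `Δ(a) = g ⊗ a + a ⊗ h`, where `g` and `h` are group-like. -/
def IsSkewPrimitive (k : Type*) {H : Type*} [Field k] [Ring H] [HopfAlgebra k H]
    (g h : GroupLike k H) (a : H) : Prop :=
  Coalgebra.comul (R := k) a = (g : H) ⊗ₜ[k] a + a ⊗ₜ[k] (h : H)

/-- The adjoint action `g ▷ x = g x g⁻¹` of a group-like element `g` on a Hopf algebra. It is the
Hopf-theoretic adjoint action `g₍₁₎ x S(g₍₂₎)`, because `Δ(g) = g ⊗ g` and `S(g) = g⁻¹`. -/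
def adjointAction {k H : Type*} [Field k] [Ring H] [HopfAlgebra k H]
    (g : GroupLike k H) (x : H) : H :=
  (g : H) * x * ((g⁻¹ : GroupLike k H) : H)

section Basis

variable {A : Type*} [Ring A] (S : Set A) [LinearOrder S]

/-- The ordered monomial `s₁ ^ e₁ * ⋯ * s_t ^ e_t`, where `s₁ > ⋯ > s_t` are the elements of the
support of `e` and `eᵢ = e sᵢ > 0`. -/
def monomial (e : S →₀ ℕ) : A :=
  ((e.support.sort (· ≥ ·)).map fun s : S => (s : A) ^ e s).prod

/-- The exponents that the height function `h` allows: `0 < e s < h s` for every `s` that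
occurs. -/
def Exponents (h : S → ℕ∞) : Type _ :=
  {e : S →₀ ℕ // ∀ s ∈ e.support, (e s : ℕ∞) < h s}

/-- The products `s₁ ^ e₁ * ⋯ * s_t ^ e_t * p` that make up the PBW set generated by `P`,
`(S, <)` and `h`, as a family indexed by the expressions (exponents, element of `P`). -/
def product (P : Set A) (h : S → ℕ∞) (b : Exponents S h × P) : A :=
  monomial S b.1.1 * (b.2 : A)

/-- The PBW set `B(P, S, <, h)`. -/
def pbwSet (P : Set A) (h : S → ℕ∞) : Set A :=
  Set.range (product S P h)

/-- `(P, S, <, h)` is a PBW basis of the `k`-algebra `A`: the heights are positive integers or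
`∞`, different expressions give different products, and the PBW set `B(P, S, <, h)` is a basis of
the vector space `A`. -/
structure IsPBWBasis (k : Type*) [Field k] [Algebra k A] (P : Set A) (h : S → ℕ∞) : Prop where
  height_pos : ∀ s, 0 < h s
  injective : Function.Injective (product S P h)
  linearIndepOn : LinearIndepOn k id (pbwSet S P h)
  span_eq_top : Submodule.span k (pbwSet S P h) = ⊤

end Basis

end PBW

end

noncomputable section

namespace PBW

/-! ### Shuffles of words -/

section Shuffle

variable {α : Type*}

/-! The proof works with leading words and Lyndon words. Commuting operators over an algebraically
closed field are simultaneously triangular, so the `aᵢ` can be replaced by finitely many letters `x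
i` with `Δ(x i) = x i ⊗ 1 + γ i ⊗ x i`, for which moving `g ∈ G` past `x i` only brings in letters
`x j` with `j ≥ i` (`TriangularLetters`). Shorter words count as lower and, among words of equal
length, lexicographically larger ones do; moving group-likes through a word therefore never raises
it. A word is reducible if its product is a combination of lower words over `kG`.

The irreducible words form a basis of `H` over `kG`. They span by well-founded induction
(`wordSpan_irreducible`). They are independent because applying `id ⊗ φ` to the coproduct of a
relation, with `φ` separating one group-like from the others, isolates a single term with the
leading word, modulo lower words (`linearIndependent_irreducible`).

It remains to identify the irreducible words with the PBW monomials. Factors of irreducible words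
are irreducible (`isReducible_append`). Conversely, `Δ` of a word is governed by the ways to write
it as a shuffle. If every nonempty suffix of `a` exceeds `b`, then in `Δ(ab)` only the term `a γ_b ⊗
b` has no factor lower than `a`, respectively `b`; this rests on `Crossing.lt_append` and makes `ab`
irreducible when `a` and `b` are (`not_isReducible_append`). Grouping equal factors in the Lyndon
factorization writes each word as a product of powers of decreasing Lyndon words, and it is
irreducible exactly when all these powers are. So `S` consists of the irreducible Lyndon words, and
the height is the first exponent whose power is reducible. -/

/-- `Shuffle u v w`: the word `w` is a shuffle of `u` and `v`. -/
inductive Shuffle {α : Type*} : List α → List α → List α → Prop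
  | nil : Shuffle [] [] []
  | left {u v w : List α} (x : α) : Shuffle u v w → Shuffle (x :: u) v (x :: w)
  | right {u v w : List α} (x : α) : Shuffle u v w → Shuffle u (x :: v) (x :: w)

/-- `Crossing u v w`: the word `w` is a shuffle of `u` and `v` in which some letter of `v` precedes
some letter of `u`. -/
inductive Crossing {α : Type*} : List α → List α → List α → Prop
  | left {u v w : List α} (x : α) : Crossing u v w → Crossing (x :: u) v (x :: w)
  | right {u v w : List α} (x y : α) : Shuffle (x :: u) v w → Crossing (x :: u) (y :: v) (y :: w)

theorem Crossing.shuffle {u v w : List α} (h : Crossing u v w) : Shuffle u v w := by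
  induction h with
  | left x _ ih => exact ih.left x
  | right x y h => exact h.right y

theorem Crossing.ne_nil {u v w : List α} (h : Crossing u v w) : u ≠ [] ∧ v ≠ [] := by
  induction h with
  | left x _ ih => exact ⟨by simp, ih.2⟩
  | right x y h => simp

theorem Shuffle.length_eq {u v w : List α} (h : Shuffle u v w) :
    u.length + v.length = w.length := by
  induction h <;> simp_all <;> omega

theorem shuffle_append (u v : List α) : Shuffle u v (u ++ v) := by
  induction u with
  | nil =>
    induction v with
    | nil => exact .nil
    | cons b v ih => exact ih.right b
  | cons a u ih => exact ih.left a

theorem exists_crossing {u v : List α} (hu : u ≠ []) (hv : v ≠ []) : ∃ w, Crossing u v w := by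
  cases u with
  | nil => exact absurd rfl hu
  | cons a u =>
    cases v with
    | nil => exact absurd rfl hv
    | cons b v => exact ⟨_, .right a b (shuffle_append _ _)⟩

theorem Shuffle.eq_append_or_crossing {u v w : List α} (h : Shuffle u v w) :
    w = u ++ v ∨ Crossing u v w := by
  induction h with
  | nil => simp
  | left x _ ih =>
    rcases ih with rfl | h
    · simp
    · exact .inr (h.left x)
  | @right u v w x h ih =>
    cases u with
    | nil =>
      rcases ih with rfl | h
      · simp
      · exact absurd rfl h.ne_nil.1
    | cons a u => exact .inr (.right a x h)

/-- A cut through a concatenation falls inside or at the end of some factor. This serves the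
uniqueness of Lyndon factorizations. -/
theorem exists_prefix_of_append_eq_flatten {L : List (List α)} {r s : List α} (hr : r ≠ [])
    (h : r ++ s = L.flatten) : ∃ q p t m, m ∈ L ∧ p ≠ [] ∧ m = p ++ t ∧ r = q ++ p := by
  induction L generalizing r with
  | nil => simp_all
  | cons m L ih =>
    rw [List.flatten_cons] at h
    rcases List.append_eq_append_iff.1 h with ⟨t, rfl, -⟩ | ⟨r', rfl, h2⟩
    · exact ⟨[], r, t, _, by simp, hr, rfl, rfl⟩
    · rcases eq_or_ne r' [] with rfl | hr'
      · exact ⟨[], m, [], m, by simp, by simpa using hr, by simp, by simp⟩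
      · obtain ⟨q, p, t, m', h3, h4, h5, rfl⟩ := ih hr' h2.symm
        exact ⟨m ++ q, p, t, m', by simp [h3], h4, h5, by simp⟩

end Shuffle

/-! ### Lexicographic order on words -/

section Words

variable {α : Type*} [LinearOrder α]

theorem cons_lt_cons {a b : α} {l m : List α} :
    a :: l < b :: m ↔ a < b ∨ a = b ∧ l < m :=
  List.cons_lt_cons_iff

theorem cons_le_cons {a b : α} {l m : List α} :
    a :: l ≤ b :: m ↔ a < b ∨ a = b ∧ l ≤ m := by
  rw [le_iff_lt_or_eq, cons_lt_cons, le_iff_lt_or_eq, List.cons.injEq]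
  tauto

theorem nil_lt_of_ne_nil {l : List α} (h : l ≠ []) : [] < l := by
  cases l with
  | nil => exact absurd rfl h
  | cons a l => exact List.nil_lt_cons a l

theorem ne_nil_of_lt {l m : List α} (h : l < m) : m ≠ [] := by
  rintro rfl
  exact absurd h (List.not_lt_nil l)

theorem append_lt_append_left (p : List α) {l m : List α} : p ++ l < p ++ m ↔ l < m := by
  induction p with
  | nil => rfl
  | cons a p ih => rw [List.cons_append, List.cons_append, cons_lt_cons, ih]; simp

theorem le_append (l m : List α) : l ≤ l ++ m := by
  rcases eq_or_ne m [] with rfl | h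
  · simp
  · have := (append_lt_append_left l).2 (nil_lt_of_ne_nil h)
    rw [List.append_nil] at this
    exact this.le

/-- Either a smaller word differs from the larger one at a letter, or it is a proper prefix. -/
theorem append_lt_append_or_prefix {l m : List α} (h : l < m) :
    (∀ r s, l ++ r < m ++ s) ∨ ∃ t, t ≠ [] ∧ m = l ++ t := by
  induction l generalizing m with
  | nil => exact .inr ⟨m, ne_nil_of_lt h, rfl⟩
  | cons a l ih =>
    cases m with
    | nil => exact absurd rfl (ne_nil_of_lt h)
    | cons b m =>
      rcases cons_lt_cons.1 h with hab | ⟨rfl, hlm⟩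
      · exact .inl fun r s => cons_lt_cons.2 (.inl hab)
      · rcases ih hlm with h1 | ⟨t, ht, rfl⟩
        · exact .inl fun r s => cons_lt_cons.2 (.inr ⟨rfl, h1 r s⟩)
        · exact .inr ⟨t, ht, rfl⟩

theorem append_lt_append_of_length_eq {l m : List α} (h : l < m) (hl : l.length = m.length)
    (r s : List α) : l ++ r < m ++ s := by
  rcases append_lt_append_or_prefix h with h1 | ⟨t, ht, rfl⟩
  · exact h1 r s
  · simp_all

/-! ### Lexicographically large shuffles -/

/-- Replacing the two constituents of a shuffle by larger words of the same lengths. -/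
theorem Shuffle.mono {u v w u' v' : List α} (h : Shuffle u v w) (hul : u.length = u'.length)
    (hvl : v.length = v'.length) (hu : u ≤ u') (hv : v ≤ v') :
    ∃ w', Shuffle u' v' w' ∧ w ≤ w' := by
  induction h generalizing u' v' with
  | nil => exact ⟨_, shuffle_append u' v', le_append [] _⟩
  | left x h ih =>
    cases u' with
    | nil => simp at hul
    | cons y u' =>
      rcases cons_le_cons.1 hu with hxy | ⟨rfl, hu₂⟩
      · exact ⟨_, (shuffle_append u' v').left y, (cons_lt_cons.2 (.inl hxy)).le⟩
      · obtain ⟨w', h1, h2⟩ := ih (by simpa using hul) hvl hu₂ hv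
        exact ⟨_, h1.left x, cons_le_cons.2 (.inr ⟨rfl, h2⟩)⟩
  | right x h ih =>
    cases v' with
    | nil => simp at hvl
    | cons y v' =>
      rcases cons_le_cons.1 hv with hxy | ⟨rfl, hv₂⟩
      · exact ⟨_, (shuffle_append u' v').right y, (cons_lt_cons.2 (.inl hxy)).le⟩
      · obtain ⟨w', h1, h2⟩ := ih hul (by simpa using hvl) hu hv₂
        exact ⟨_, h1.right x, cons_le_cons.2 (.inr ⟨rfl, h2⟩)⟩

/-- Once a leading letter has strictly increased, the rest is free, and any crossing of the
remainders will do. -/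
theorem Crossing.mono {u v w u' v' : List α} (h : Crossing u v w) (hul : u.length = u'.length)
    (hvl : v.length = v'.length) (hu : u ≤ u') (hv : v ≤ v') :
    ∃ w', Crossing u' v' w' ∧ w ≤ w' := by
  induction h generalizing u' v' with
  | left x h ih =>
    cases u' with
    | nil => simp at hul
    | cons y u' =>
      rcases cons_le_cons.1 hu with hxy | ⟨rfl, hu₂⟩
      · have hu' : u' ≠ [] := by
          rintro rfl
          exact h.ne_nil.1 (by simpa using hul)
        have hv' : v' ≠ [] := by
          rintro rfl
          exact h.ne_nil.2 (by simpa using hvl)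
        obtain ⟨w', hw'⟩ := exists_crossing hu' hv'
        exact ⟨_, hw'.left y, (cons_lt_cons.2 (.inl hxy)).le⟩
      · obtain ⟨w', h1, h2⟩ := ih (by simpa using hul) hvl hu₂ hv
        exact ⟨_, h1.left x, cons_le_cons.2 (.inr ⟨rfl, h2⟩)⟩
  | right x y h =>
    cases u' with
    | nil => simp at hul
    | cons a u' =>
      cases v' with
      | nil => simp at hvl
      | cons b v' =>
        rcases cons_le_cons.1 hv with hxy | ⟨rfl, hv₂⟩
        · exact ⟨_, .right a b (shuffle_append _ _), (cons_lt_cons.2 (.inl hxy)).le⟩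
        · obtain ⟨w', h1, h2⟩ := h.mono hul (by simpa using hvl) hu hv₂
          exact ⟨_, .right a y h1, cons_le_cons.2 (.inr ⟨rfl, h2⟩)⟩

/-- Moving a prefix `p` from the larger to the smaller constituent makes the shuffles larger. -/
theorem Shuffle.exchange {p u v w : List α} (h : Shuffle (p ++ u) v w) (hvu : v < u)
    (hp : p ≠ []) : (∃ w', Crossing u (p ++ v) w' ∧ w ≤ w') ∨
      ∃ w', Shuffle u (p ++ v) w' ∧ w < w' := by
  induction w generalizing p u v with
  | nil =>
    have := h.length_eq
    cases p <;> simp_all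
  | cons c w ih =>
    obtain ⟨a, u, rfl⟩ := List.exists_cons_of_ne_nil (ne_nil_of_lt hvu)
    obtain ⟨b, p, rfl⟩ := List.exists_cons_of_ne_nil hp
    cases h with
    | left _ h =>
      rcases eq_or_ne p [] with rfl | hp
      · exact .inl ⟨_, .right a _ h, le_rfl⟩
      · rcases ih h hvu hp with ⟨w', h1, h2⟩ | ⟨w', h1, h2⟩
        · exact .inl ⟨_, .right a _ h1.shuffle, cons_le_cons.2 (.inr ⟨rfl, h2⟩)⟩
        · exact .inl ⟨_, .right a _ h1, cons_le_cons.2 (.inr ⟨rfl, h2.le⟩)⟩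
    | @right _ v _ _ h =>
      rcases cons_lt_cons.1 hvu with hca | ⟨rfl, hvu₂⟩
      · exact .inr ⟨_, (shuffle_append u _).left a, cons_lt_cons.2 (.inl hca)⟩
      -- The leading letter of `v` equals that of `u`, so it can be taken from `u` instead; the copy
      -- from `v` joins the end of `p`.
      · have h' : Shuffle ((b :: p ++ [c]) ++ u) v w := by simpa using h
        rcases ih h' hvu₂ (by simp) with ⟨w', h1, h2⟩ | ⟨w', h1, h2⟩
        · exact .inl ⟨_, Crossing.left c (by simpa using h1), cons_le_cons.2 (.inr ⟨rfl, h2⟩)⟩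
        · exact .inr ⟨_, Shuffle.left c (by simpa using h1), cons_lt_cons.2 (.inr ⟨rfl, h2⟩)⟩

/-- Only a first letter taken from `v` and equal to that of `u` is delicate. `Shuffle.exchange` then
trades it for the one in `u`, without making the word smaller, and leaves a shorter `u`. -/
theorem Crossing.lt_append {u v w : List α} (h : Crossing u v w)
    (huv : ∀ s, s <:+ u → s ≠ [] → v < s) : w < u ++ v := by
  induction u generalizing w with
  | nil => exact absurd rfl h.ne_nil.1
  | cons a u ih =>
    have ih' : ∀ {w}, Crossing u v w → w < u ++ v := fun hw =>
      ih hw fun s hs => huv s (hs.trans (List.suffix_cons a u))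
    cases h with
    | left _ h => exact cons_lt_cons.2 (.inr ⟨rfl, ih' h⟩)
    | @right _ v w _ c h =>
      rcases cons_lt_cons.1 (huv _ List.suffix_rfl (by simp)) with hca | ⟨rfl, hvu⟩
      · exact cons_lt_cons.2 (.inl hca)
      · refine cons_lt_cons.2 (.inr ⟨rfl, ?_⟩)
        have h' : Shuffle ([c] ++ u) v w := h
        rcases h'.exchange hvu (by simp) with ⟨w', h1, h2⟩ | ⟨w', h1, h2⟩
        · exact h2.trans_lt (ih' h1)
        · rcases h1.eq_append_or_crossing with rfl | h1
          · exact h2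
          · exact h2.trans (ih' h1)

theorem Shuffle.le_append {u v w : List α} (h : Shuffle u v w)
    (huv : ∀ s, s <:+ u → s ≠ [] → v < s) : w ≤ u ++ v := by
  rcases h.eq_append_or_crossing with rfl | h
  · exact le_rfl
  · exact (h.lt_append huv).le

/-! ### Lyndon words -/

/-- A Lyndon word: a nonempty word that is smaller than its proper nonempty suffixes. -/
def IsLyndon (w : List α) : Prop :=
  w ≠ [] ∧ ∀ s t, w = s ++ t → s ≠ [] → t ≠ [] → w < t

theorem isLyndon_singleton (a : α) : IsLyndon [a] := by
  refine ⟨by simp, fun s t h hs ht => ?_⟩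
  have h1 := congrArg List.length h
  rw [List.length_singleton, List.length_append] at h1
  have := List.length_pos_of_ne_nil hs
  have := List.length_pos_of_ne_nil ht
  omega

theorem IsLyndon.le_of_suffix {l s : List α} (hl : IsLyndon l) (hs : s <:+ l) (hs' : s ≠ []) :
    l ≤ s := by
  obtain ⟨t, rfl⟩ := hs
  rcases eq_or_ne t [] with rfl | ht
  · simp
  · exact (hl.2 t s rfl ht hs').le

theorem IsLyndon.append {l m : List α} (hl : IsLyndon l) (hm : IsLyndon m) (h : l < m) :
    IsLyndon (l ++ m) := by
  have hlm : l ++ m < m := by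
    rcases append_lt_append_or_prefix h with h1 | ⟨t, ht, rfl⟩
    · simpa using h1 m []
    · exact (append_lt_append_left l).2 (hm.2 l t rfl hl.1 ht)
  refine ⟨by simp [hl.1], fun s t hst hs ht => ?_⟩
  rcases List.append_eq_append_iff.1 hst with ⟨r, rfl, rfl⟩ | ⟨r, rfl, rfl⟩
  · exact hlm.trans_le (hm.le_of_suffix (List.suffix_append r t) ht)
  · rcases eq_or_ne r [] with rfl | hr
    · simpa using hlm
    -- The suffix `r` of `l` is shorter than `l`, so the inequality `l < r` is decided at a letter
    -- and survives appending `m`.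
    · rcases append_lt_append_or_prefix (hl.2 s r rfl hs hr) with h1 | ⟨t, ht, h2⟩
      · exact h1 m m
      · have := congrArg List.length h2
        have := List.length_pos_of_ne_nil hs
        simp at *
        omega

theorem exists_lyndon_cons (m : List α) (hm : IsLyndon m) (L : List (List α))
    (hL : ∀ l ∈ L, IsLyndon l) (hL' : L.Pairwise (· ≥ ·)) :
    ∃ L' : List (List α), (∀ l ∈ L', IsLyndon l) ∧ L'.Pairwise (· ≥ ·) ∧
      L'.flatten = m ++ L.flatten := by
  induction L generalizing m with
  | nil => exact ⟨[m], by simpa using hm, by simp, by simp⟩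
  | cons l L ih =>
    rw [List.pairwise_cons] at hL'
    rcases le_or_gt l m with h | h
    · refine ⟨m :: l :: L, by simp_all, ?_, by simp⟩
      refine List.pairwise_cons.2 ⟨fun x hx => ?_, List.pairwise_cons.2 hL'⟩
      rcases List.mem_cons.1 hx with rfl | hx
      · exact h
      · exact (hL'.1 x hx).le.trans h
    · obtain ⟨L', h1, h2, h3⟩ := ih (m ++ l) (hm.append (hL l (by simp)) h)
        (fun x hx => hL x (by simp [hx])) hL'.2
      exact ⟨L', h1, h2, by simp [h3]⟩

/-- Every word is a product of a nonincreasing sequence of Lyndon words. -/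
theorem exists_lyndon_factorization (w : List α) :
    ∃ L : List (List α), (∀ l ∈ L, IsLyndon l) ∧ L.Pairwise (· ≥ ·) ∧ L.flatten = w := by
  induction w with
  | nil => exact ⟨[], by simp⟩
  | cons a w ih =>
    obtain ⟨L, h1, h2, rfl⟩ := ih
    simpa using exists_lyndon_cons [a] (isLyndon_singleton a) L h1 h2

/-- If `r` were nonempty, it would end in a prefix `p` of some factor `x ≤ m`, and `p` would be a
proper suffix of `l`; then `l < p ≤ x ≤ m ≤ l`. -/
theorem lyndon_eq_of_append_eq {l m r : List α} {L : List (List α)} (hl : IsLyndon l)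
    (hm : IsLyndon m) (hL : ∀ x ∈ L, x ≤ m) {s : List α} (hlm : l = m ++ r)
    (h : r ++ s = L.flatten) : l = m := by
  rcases eq_or_ne r [] with rfl | hr
  · simpa using hlm
  · obtain ⟨q, p, t, x, hx, hp, rfl, rfl⟩ := exists_prefix_of_append_eq_flatten hr h
    have h1 : l < p := hl.2 (m ++ q) p (by simp [hlm]) (by simp [hm.1]) hp
    have h2 : p ≤ m := (le_append p t).trans (hL _ hx)
    have h3 : m ≤ l := hlm ▸ le_append m _
    exact absurd (h1.trans_le (h2.trans h3)) (lt_irrefl _)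

/-- The factorization into a nonincreasing sequence of Lyndon words is unique. -/
theorem lyndon_factorization_unique {L M : List (List α)} (hL : ∀ l ∈ L, IsLyndon l)
    (hL' : L.Pairwise (· ≥ ·)) (hM : ∀ l ∈ M, IsLyndon l) (hM' : M.Pairwise (· ≥ ·))
    (h : L.flatten = M.flatten) : L = M := by
  induction L generalizing M with
  | nil =>
    cases M with
    | nil => rfl
    | cons m M => exact absurd (by simp_all) (hM m (by simp)).1
  | cons l L ih =>
    cases M with
    | nil => exact absurd (by simp_all) (hL l (by simp)).1
    | cons m M =>
      rw [List.pairwise_cons] at hL' hM'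
      rw [List.flatten_cons, List.flatten_cons] at h
      have hl := hL l (by simp)
      have hm := hM m (by simp)
      have hlm : l = m := by
        rcases List.append_eq_append_iff.1 h with ⟨r, h1, h2⟩ | ⟨r, h1, h2⟩
        · exact (lyndon_eq_of_append_eq hm hl hL'.1 h1 h2.symm).symm
        · exact lyndon_eq_of_append_eq hl hm hM'.1 h1 h2.symm
      subst hlm
      rw [ih (fun x hx => hL x (by simp [hx])) hL'.2 (fun x hx => hM x (by simp [hx])) hM'.2
        (List.append_cancel_left h)]

theorem IsLyndon.le_of_suffix_pow {l s : List α} (hl : IsLyndon l) (n : ℕ)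
    (hs : s <:+ (List.replicate n l).flatten) (hs' : s ≠ []) : l ≤ s := by
  induction n with
  | zero => simp_all
  | succ n ih =>
    rw [List.replicate_succ, List.flatten_cons] at hs
    obtain ⟨t, ht⟩ := hs
    rcases List.append_eq_append_iff.1 ht with ⟨r, rfl, rfl⟩ | ⟨r, rfl, h2⟩
    · rcases eq_or_ne r [] with rfl | hr
      · exact ih (by simp)
      · exact (hl.le_of_suffix (List.suffix_append t r) hr).trans (le_append _ _)
    · exact ih ⟨r, h2.symm⟩

/-- Either `m` and `s` differ at a letter, or `m` is a proper prefix of `s` and the remaining suffix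
inherits the hypothesis. -/
theorem flatten_lt {L : List (List α)} {s : List α} (hs : s ≠ [])
    (h : ∀ t, t <:+ s → t ≠ [] → ∀ m ∈ L, m < t) : L.flatten < s := by
  induction L generalizing s with
  | nil => exact nil_lt_of_ne_nil hs
  | cons m L ih =>
    rcases append_lt_append_or_prefix (h s List.suffix_rfl hs m (by simp)) with h1 | ⟨t, ht, rfl⟩
    · simpa using h1 L.flatten []
    · refine (append_lt_append_left m).2 (ih ht fun r hr hr' x hx => ?_)
      exact h r (hr.trans (List.suffix_append m t)) hr' x (by simp [hx])

/-- Every nonempty suffix of a power of a Lyndon word `l` exceeds all products of words smaller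
than `l`. -/
theorem IsLyndon.flatten_lt_of_suffix_pow {l s : List α} (hl : IsLyndon l) (n : ℕ)
    {L : List (List α)} (hL : ∀ m ∈ L, m < l) (hs : s <:+ (List.replicate n l).flatten)
    (hs' : s ≠ []) : L.flatten < s :=
  flatten_lt hs' fun _ ht ht' m hm =>
    (hL m hm).trans_le (hl.le_of_suffix_pow n (ht.trans hs) ht')

end Words

/-! ### The order on words used for leading terms -/

section Below

variable {I : Type*} [LinearOrder I]

/-- The words that are shorter than `w`, or of the same length and lexicographically larger. -/
def below (w : List I) : Set (List I) :=
  {v | v.length < w.length ∨ v.length = w.length ∧ w < v}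

/-- The words of the same length as `w` that are lexicographically not smaller. -/
def upper (w : List I) : Set (List I) :=
  {v | v.length = w.length ∧ w ≤ v}

theorem upper_subset_below {v w : List I} (h : v ∈ below w) : upper v ⊆ below w := by
  rintro u ⟨h1, h2⟩
  rcases h with h | ⟨h, h'⟩
  · exact .inl (h1.trans_lt h)
  · exact .inr ⟨h1.trans h, h'.trans_le h2⟩

theorem below_trichotomy (v w : List I) : v ∈ below w ∨ v = w ∨ w ∈ below v := by
  rcases lt_trichotomy v.length w.length with h | h | h
  · exact .inl (.inl h)
  · rcases lt_trichotomy v w with h' | h' | h'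
    · exact .inr (.inr (.inr ⟨h.symm, h'⟩))
    · exact .inr (.inl h')
    · exact .inl (.inr ⟨h, h'⟩)
  · exact .inr (.inr (.inl h))

theorem below_subset_below {v w : List I} (h : v ∈ below w) : below v ⊆ below w := by
  rintro u (h1 | ⟨h1, h2⟩)
  · rcases h with h | ⟨h, h'⟩
    · exact .inl (h1.trans h)
    · exact .inl (h1.trans_eq h)
  · exact upper_subset_below h ⟨h1, h2.le⟩

/-- Over a finite alphabet there are finitely many words of each length, so the pair (length, number
of larger words of that length) decreases. -/
theorem wellFounded_below [Finite I] : WellFounded fun v w : List I => v ∈ below w := by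
  let f : List I → ℕ × ℕ := fun w => (w.length, {v | v.length = w.length ∧ w < v}.ncard)
  refine Subrelation.wf (r := InvImage (Prod.Lex (· < ·) (· < ·)) f) ?_
    (InvImage.wf f (WellFounded.prod_lex wellFounded_lt wellFounded_lt))
  intro v w h
  rcases h with h | ⟨h, h'⟩
  · exact Prod.Lex.left _ _ h
  · have : f v = (w.length, {u | u.length = v.length ∧ v < u}.ncard) := by rw [← h]
    change Prod.Lex _ _ (f v) (f w)
    rw [this]
    refine Prod.Lex.right _ (Set.ncard_lt_ncard ⟨?_, ?_⟩ ?_)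
    · rintro u ⟨h1, h2⟩
      exact ⟨h1.trans h, h'.trans h2⟩
    · exact fun hs => lt_irrefl _ (hs ⟨h, h'⟩ : _ ∧ v < v).2
    · exact (List.finite_length_eq I w.length).subset fun u hu => hu.1

theorem exists_forall_eq_or_mem_below {ι : Type*} (s : Finset ι) (hs : s.Nonempty)
    (f : ι → List I) : ∃ i ∈ s, ∀ j ∈ s, f j = f i ∨ f j ∈ below (f i) := by
  induction hs using Finset.Nonempty.cons_induction with
  | singleton a => simp
  | cons a s ha hs ih =>
    obtain ⟨i, hi, h⟩ := ih
    rcases below_trichotomy (f a) (f i) with h1 | h1 | h1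
    · refine ⟨i, by simp [hi], fun j hj => ?_⟩
      rcases Finset.mem_cons.1 hj with rfl | hj
      exacts [.inr h1, h j hj]
    · refine ⟨i, by simp [hi], fun j hj => ?_⟩
      rcases Finset.mem_cons.1 hj with rfl | hj
      exacts [.inl h1, h j hj]
    · refine ⟨a, by simp, fun j hj => ?_⟩
      rcases Finset.mem_cons.1 hj with rfl | hj
      · exact .inl rfl
      · rcases h j hj with h2 | h2
        · exact .inr (h2 ▸ h1)
        · exact .inr (below_subset_below h1 h2)

theorem append_append_mem_below {v w q q' : List I} (p : List I) (h : v ∈ below w)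
    (hq : q'.length = q.length) : p ++ v ++ q' ∈ below (p ++ w ++ q) := by
  rcases h with h | ⟨h, h'⟩
  · left
    simp only [List.length_append]
    omega
  · right
    refine ⟨by simp only [List.length_append]; omega, ?_⟩
    rw [List.append_assoc, List.append_assoc]
    exact (append_lt_append_left p).2 (append_lt_append_of_length_eq h' h.symm _ _)

theorem cons_mem_upper_cons {i j : I} {v w : List I} (hij : i ≤ j) (h : v ∈ upper w) :
    j :: v ∈ upper (i :: w) :=
  ⟨by simp [h.1], cons_le_cons.2 (hij.lt_or_eq.imp_right fun e => ⟨e, h.2⟩)⟩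

theorem mem_upper_self (w : List I) : w ∈ upper w := ⟨rfl, le_rfl⟩

theorem upper_subset_upper {v w : List I} (h : v ∈ upper w) : upper v ⊆ upper w :=
  fun _ hu => ⟨hu.1.trans h.1, h.2.trans hu.2⟩

/-- Otherwise the lengths agree and `u ≤ a`, `v ≤ b`; by monotonicity some shuffle of `a` and `b`
would exceed `a ++ b`. -/
theorem mem_below_or_of_shuffle {u v w a b : List I} (h : Shuffle u v w)
    (hab : ∀ s, s <:+ a → s ≠ [] → b < s) (hw : w ∈ below (a ++ b)) :
    u ∈ below a ∨ v ∈ below b := by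
  by_contra! hc
  simp only [below, Set.mem_ofPred_eq, not_or, not_and, not_lt] at hc
  have hl := h.length_eq
  rcases hw with hw | ⟨hw, hlt⟩
  · rw [List.length_append] at hw
    omega
  · rw [List.length_append] at hw
    have h1 : u.length = a.length := by omega
    have h2 : v.length = b.length := by omega
    obtain ⟨w', h3, h4⟩ := h.mono h1 h2 (hc.1.2 h1) (hc.2.2 h2)
    exact absurd (hlt.trans_le (h4.trans (h3.le_append hab))) (lt_irrefl _)

/-- Here the word is `a ++ b` itself, so the strict bound for crossings is needed. -/
theorem mem_below_or_of_crossing {u v a b : List I} (h : Crossing u v (a ++ b))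
    (hab : ∀ s, s <:+ a → s ≠ [] → b < s) : u ∈ below a ∨ v ∈ below b := by
  by_contra! hc
  simp only [below, Set.mem_ofPred_eq, not_or, not_and, not_lt] at hc
  have hl := h.shuffle.length_eq
  rw [List.length_append] at hl
  have h1 : u.length = a.length := by omega
  have h2 : v.length = b.length := by omega
  obtain ⟨w', h3, h4⟩ := h.mono h1 h2 (hc.1.2 h1) (hc.2.2 h2)
  exact absurd (h4.trans_lt (h3.lt_append hab)) (lt_irrefl _)

end Below

section Spans

/-! ### Spans of words -/

variable {k : Type*} [Field k] {H : Type*} [Ring H] [HopfAlgebra k H]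
  {I : Type*}

/-- The product in `H` of the letters of a word. -/
def wordProd (x : I → H) (w : List I) : H :=
  (w.map x).prod

theorem wordProd_cons (x : I → H) (i : I) (w : List I) :
    wordProd x (i :: w) = x i * wordProd x w := by
  simp [wordProd]

theorem wordProd_append (x : I → H) (v w : List I) :
    wordProd x (v ++ w) = wordProd x v * wordProd x w := by
  simp [wordProd]

theorem wordProd_flatten (x : I → H) (L : List (List I)) :
    wordProd x L.flatten = (L.map (wordProd x)).prod := by
  induction L with
  | nil => simp [wordProd]
  | cons w L ih => rw [List.flatten_cons, wordProd_append, ih, List.map_cons, List.prod_cons]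

/-- The span of the elements `w * g`, for words `w` in a given set and `g ∈ G`. -/
def wordSpan (G : Subgroup (GroupLike k H)) (x : I → H) (P : Set (List I)) : Submodule k H :=
  Submodule.span k {z | ∃ w ∈ P, ∃ g ∈ G, z = wordProd x w * (g : H)}

variable {G : Subgroup (GroupLike k H)} {x : I → H} {γ : I → GroupLike k H}

theorem wordProd_mul_mem {P : Set (List I)} {w : List I} (hw : w ∈ P) {g : GroupLike k H}
    (hg : g ∈ G) : wordProd x w * (g : H) ∈ wordSpan G x P :=
  Submodule.subset_span ⟨w, hw, g, hg, rfl⟩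

theorem wordProd_mem {P : Set (List I)} {w : List I} (hw : w ∈ P) :
    wordProd x w ∈ wordSpan G x P := by
  simpa using wordProd_mul_mem (x := x) hw G.one_mem

theorem wordSpan_le {P : Set (List I)} {N : Submodule k H}
    (h : ∀ w ∈ P, ∀ g ∈ G, wordProd x w * (g : H) ∈ N) : wordSpan G x P ≤ N := by
  refine Submodule.span_le.2 ?_
  rintro _ ⟨w, hw, g, hg, rfl⟩
  exact h w hw g hg

theorem wordSpan_mono {P Q : Set (List I)} (h : P ⊆ Q) : wordSpan G x P ≤ wordSpan G x Q :=
  wordSpan_le fun _ hw _ hg => wordProd_mul_mem (h hw) hg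

theorem mul_mem_wordSpan {P : Set (List I)} {z : H} (hz : z ∈ wordSpan G x P)
    {g : GroupLike k H} (hg : g ∈ G) : z * (g : H) ∈ wordSpan G x P := by
  have : wordSpan G x P ≤ (wordSpan G x P).comap (LinearMap.mulRight k (g : H)) :=
    wordSpan_le fun w hw g' hg' => by
      simpa [mul_assoc] using wordProd_mul_mem (x := x) hw (G.mul_mem hg' hg)
  exact this hz

theorem wordProd_mul_mem_wordSpan {P Q : Set (List I)} {z : H} (hz : z ∈ wordSpan G x P)
    (p : List I) (h : ∀ w ∈ P, p ++ w ∈ Q) : wordProd x p * z ∈ wordSpan G x Q := by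
  have : wordSpan G x P ≤ (wordSpan G x Q).comap (LinearMap.mulLeft k (wordProd x p)) :=
    wordSpan_le fun w hw g' hg' => by
      simpa [mul_assoc, wordProd_append] using wordProd_mul_mem (x := x) (h w hw) hg'
  exact this hz

theorem letter_mul_mem_wordSpan {P Q : Set (List I)} {z : H} (hz : z ∈ wordSpan G x P)
    (i : I) (h : ∀ w ∈ P, i :: w ∈ Q) : x i * z ∈ wordSpan G x Q := by
  simpa [wordProd] using wordProd_mul_mem_wordSpan hz [i] h

theorem exists_functional {N : Submodule k H} {y : H} (hy : y ∉ N) :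
    ∃ φ : H →ₗ[k] k, (∀ z ∈ N, φ z = 0) ∧ φ y = 1 := by
  obtain ⟨φ, h1, h2⟩ := Submodule.exists_le_ker_of_notMem hy
  exact ⟨(φ y)⁻¹ • φ, fun z hz => by simp [LinearMap.mem_ker.1 (h2 hz)], by simp [h1]⟩

theorem mem_of_mul_mem {P : Set (List I)} {z : H} {g : GroupLike k H} (hg : g ∈ G)
    (h : z * (g : H) ∈ wordSpan G x P) : z ∈ wordSpan G x P := by
  have h1 := mul_mem_wordSpan h (G.inv_mem hg)
  have h2 : (g : H) * ((g⁻¹ : GroupLike k H) : H) = 1 := by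
    rw [← GroupLike.val_mul, mul_inv_cancel, GroupLike.val_one]
  rwa [mul_assoc, h2, mul_one] at h1

variable [LinearOrder I]

/-- A word is reducible if its product is a linear combination of words that are shorter, or of
the same length and lexicographically larger, with coefficients in the group algebra. -/
def IsReducible (G : Subgroup (GroupLike k H)) (x : I → H) (w : List I) : Prop :=
  wordProd x w ∈ wordSpan G x (below w)

/-- The span of the tensors that come from the shuffles, of a given kind, that give `w`. -/
def tensorSpan (G : Subgroup (GroupLike k H)) (x : I → H)
    (R : List I → List I → List I → Prop) (w : List I) : Submodule k (H ⊗[k] H) :=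
  Submodule.span k {t | ∃ u v, R u v w ∧ ∃ y ∈ wordSpan G x (upper u),
    ∃ z ∈ wordSpan G x (upper v), t = y ⊗ₜ[k] z}

theorem tmul_mem {R : List I → List I → List I → Prop} {u v w : List I} (h : R u v w) {y z : H}
    (hy : y ∈ wordSpan G x (upper u)) (hz : z ∈ wordSpan G x (upper v)) :
    y ⊗ₜ[k] z ∈ tensorSpan G x R w :=
  Submodule.subset_span ⟨u, v, h, y, hy, z, hz, rfl⟩

theorem tensorSpan_le {R : List I → List I → List I → Prop} {w : List I}
    {N : Submodule k (H ⊗[k] H)} (h : ∀ u v, R u v w → ∀ y ∈ wordSpan G x (upper u),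
      ∀ z ∈ wordSpan G x (upper v), y ⊗ₜ[k] z ∈ N) : tensorSpan G x R w ≤ N := by
  refine Submodule.span_le.2 ?_
  rintro _ ⟨u, v, hR, y, hy, z, hz, rfl⟩
  exact h u v hR y hy z hz

theorem letter_tmul_one_mul_mem (i : I) {w : List I} {t : H ⊗[k] H}
    (ht : t ∈ tensorSpan G x Crossing w) :
    (x i ⊗ₜ[k] (1 : H)) * t ∈ tensorSpan G x Crossing (i :: w) := by
  have : tensorSpan G x Crossing w ≤ (tensorSpan G x Crossing (i :: w)).comap
      (LinearMap.mulLeft k (x i ⊗ₜ[k] (1 : H))) :=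
    tensorSpan_le fun u v h y hy z hz => by
      simp only [Submodule.mem_comap, LinearMap.mulLeft_apply,
        Algebra.TensorProduct.tmul_mul_tmul, one_mul]
      exact tmul_mem (h.left i)
        (letter_mul_mem_wordSpan hy i fun _ => cons_mem_upper_cons le_rfl) hz
  exact this ht

/-- The tensor `u * γ_v ⊗ v` that belongs to the decomposition `w = u v` with `u` of length `n`. -/
def cutTensor (x : I → H) (γ : I → GroupLike k H) (w : List I) (n : ℕ) : H ⊗[k] H :=
  (wordProd x (w.take n) * (((w.drop n).map γ).prod : GroupLike k H)) ⊗ₜ[k] wordProd x (w.drop n)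

theorem wordSpan_irreducible [Finite I] (h : wordSpan G x Set.univ = ⊤) :
    wordSpan G x {w | ¬ IsReducible G x w} = ⊤ := by
  refine top_le_iff.1 (h ▸ wordSpan_le fun w _ => ?_)
  induction w using (wellFounded_below (I := I)).induction with
  | _ w ih =>
    intro g hg
    by_cases hw : IsReducible G x w
    · exact wordSpan_le (fun v hv g hg => ih v hv trivial g hg) (mul_mem_wordSpan hw hg)
    · exact wordProd_mul_mem hw hg

/-- Letters `x i` with `Δ(x i) = x i ⊗ 1 + γ i ⊗ x i`, on which `G` acts triangularly. -/
structure TriangularLetters (G : Subgroup (GroupLike k H)) (x : I → H)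
    (γ : I → GroupLike k H) : Prop where
  mem : ∀ i, γ i ∈ G
  comul : ∀ i, Coalgebra.comul (R := k) (x i) = x i ⊗ₜ[k] (1 : H) + (γ i : H) ⊗ₜ[k] x i
  mul_mem : ∀ g ∈ G, ∀ i, (g : H) * x i ∈
    Submodule.span k {z : H | ∃ j, i ≤ j ∧ z = x j * (g : H)}

namespace TriangularLetters

variable (hx : TriangularLetters G x γ)

include hx

theorem groupLike_mul_wordProd_mem {g : GroupLike k H} (hg : g ∈ G) (w : List I) :
    (g : H) * wordProd x w ∈ wordSpan G x (upper w) := by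
  induction w with
  | nil =>
    simpa [wordProd] using wordProd_mul_mem (x := x) (mem_upper_self ([] : List I)) hg
  | cons i w ih =>
    rw [wordProd_cons, ← mul_assoc]
    have : Submodule.span k {z : H | ∃ j, i ≤ j ∧ z = x j * (g : H)} ≤
        (wordSpan G x (upper (i :: w))).comap (LinearMap.mulRight k (wordProd x w)) := by
      refine Submodule.span_le.2 ?_
      rintro _ ⟨j, hij, rfl⟩
      simp only [SetLike.mem_coe, Submodule.mem_comap, LinearMap.mulRight_apply, mul_assoc]
      exact letter_mul_mem_wordSpan ih j fun v hv => cons_mem_upper_cons hij hv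
    exact this (hx.mul_mem g hg i)

theorem groupLike_mul_mem {P Q : Set (List I)} {z : H} (hz : z ∈ wordSpan G x P)
    {g : GroupLike k H} (hg : g ∈ G) (h : ∀ w ∈ P, upper w ⊆ Q) :
    (g : H) * z ∈ wordSpan G x Q := by
  have : wordSpan G x P ≤ (wordSpan G x Q).comap (LinearMap.mulLeft k (g : H)) :=
    wordSpan_le fun w hw g' hg' => by
      simp only [Submodule.mem_comap, LinearMap.mulLeft_apply, ← mul_assoc]
      exact mul_mem_wordSpan (wordSpan_mono (h w hw) (hx.groupLike_mul_wordProd_mem hg w)) hg'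
  exact this hz

/-- Group-likes arising between `v` and `q` turn `q` only into words of the same length, so the
strict comparison of `v` with `w` still decides. -/
theorem isReducible_append {w : List I} (hw : IsReducible G x w) (p q : List I) :
    IsReducible G x (p ++ w ++ q) := by
  have : wordSpan G x (below w) ≤ (wordSpan G x (below (p ++ w ++ q))).comap
      (LinearMap.mulLeft k (wordProd x p) ∘ₗ LinearMap.mulRight k (wordProd x q)) := by
    refine wordSpan_le fun v hv g hg => ?_
    have := wordProd_mul_mem_wordSpan (Q := below (p ++ w ++ q))
      (hx.groupLike_mul_wordProd_mem hg q) (p ++ v)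
      fun q' hq' => append_append_mem_below p hv hq'.1
    simpa [wordProd_append, mul_assoc] using this
  have := this hw
  simpa [IsReducible, wordProd_append, mul_assoc] using this

/-! ### The coproduct of a word -/

theorem groupLike_tmul_letter_mul_mem (i : I) {w : List I} {t : H ⊗[k] H}
    (ht : t ∈ tensorSpan G x Crossing w) :
    ((γ i : H) ⊗ₜ[k] x i) * t ∈ tensorSpan G x Crossing (i :: w) := by
  have : tensorSpan G x Crossing w ≤ (tensorSpan G x Crossing (i :: w)).comap
      (LinearMap.mulLeft k ((γ i : H) ⊗ₜ[k] x i)) :=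
    tensorSpan_le fun u v h y hy z hz => by
      simp only [Submodule.mem_comap, LinearMap.mulLeft_apply,
        Algebra.TensorProduct.tmul_mul_tmul]
      obtain ⟨a, u, rfl⟩ := List.exists_cons_of_ne_nil h.ne_nil.1
      exact tmul_mem (.right a i h.shuffle)
        (hx.groupLike_mul_mem hy (hx.mem i) fun _ => upper_subset_upper)
        (letter_mul_mem_wordSpan hz i fun _ => cons_mem_upper_cons le_rfl)
  exact this ht

theorem prod_mem (w : List I) : (w.map γ).prod ∈ G :=
  G.list_prod_mem fun g hg => by
    obtain ⟨i, -, rfl⟩ := List.mem_map.1 hg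
    exact hx.mem i

/-- The coproduct of a word, up to the terms coming from crossing shuffles. -/
theorem comul_wordProd (w : List I) :
    Coalgebra.comul (R := k) (wordProd x w) - ∑ n ∈ Finset.range (w.length + 1), cutTensor x γ w n ∈
      tensorSpan G x Crossing w := by
  induction w with
  | nil => simp [cutTensor, wordProd, Algebra.TensorProduct.one_def]
  | cons i w ih =>
    set c := Coalgebra.comul (R := k) (wordProd x w) -
      ∑ n ∈ Finset.range (w.length + 1), cutTensor x γ w n with hc
    have h1 : Coalgebra.comul (R := k) (wordProd x w) =
      c + ∑ n ∈ Finset.range (w.length + 1), cutTensor x γ w n := by simp [hc]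
    have h2 : ∀ n, (x i ⊗ₜ[k] (1 : H)) * cutTensor x γ w n = cutTensor x γ (i :: w) (n + 1) := by
      intro n
      simp [cutTensor, wordProd_cons, mul_assoc]
    have h3 : ((γ i : H) ⊗ₜ[k] x i) * cutTensor x γ w 0 = cutTensor x γ (i :: w) 0 := by
      simp [cutTensor, wordProd]
    -- The left part of such a cut is nonempty, so putting `i` in front of the right part creates a
    -- crossing.
    have h4 : ∀ n ∈ Finset.range w.length, ((γ i : H) ⊗ₜ[k] x i) * cutTensor x γ w (n + 1) ∈
        tensorSpan G x Crossing (i :: w) := by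
      intro n hn
      simp only [cutTensor, Algebra.TensorProduct.tmul_mul_tmul, ← mul_assoc]
      obtain ⟨a, u, hu⟩ := List.exists_cons_of_ne_nil (l := w.take (n + 1)) (by
        intro h
        have h5 := congrArg List.length h
        rw [Finset.mem_range] at hn
        rw [List.length_take, List.length_nil] at h5
        omega)
      have h5 := Crossing.right a i (shuffle_append (a :: u) (w.drop (n + 1)))
      rw [← hu, List.take_append_drop] at h5
      exact tmul_mem h5
        (mul_mem_wordSpan (hx.groupLike_mul_wordProd_mem (hx.mem i) _) (hx.prod_mem _))
        (letter_mul_mem_wordSpan (wordProd_mem (mem_upper_self _)) i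
          fun _ => cons_mem_upper_cons le_rfl)
    have h6 : Coalgebra.comul (R := k) (wordProd x (i :: w)) -
        ∑ n ∈ Finset.range ((i :: w).length + 1), cutTensor x γ (i :: w) n =
        (x i ⊗ₜ[k] (1 : H)) * c + ((γ i : H) ⊗ₜ[k] x i) * c +
          ∑ n ∈ Finset.range w.length, ((γ i : H) ⊗ₜ[k] x i) * cutTensor x γ w (n + 1) := by
      rw [wordProd_cons, Bialgebra.comul_mul, hx.comul, h1, List.length_cons,
        Finset.sum_range_succ' _ (w.length + 1), ← h3, add_mul, mul_add, mul_add,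
        Finset.mul_sum, Finset.mul_sum, Finset.sum_congr rfl fun n _ => h2 n,
        Finset.sum_range_succ' (fun n => ((γ i : H) ⊗ₜ[k] x i) * cutTensor x γ w n)]
      abel
    rw [h6]
    exact add_mem (add_mem (letter_tmul_one_mul_mem i ih) (hx.groupLike_tmul_letter_mul_mem i ih))
      (Submodule.sum_mem _ h4)

theorem cutTensor_mem (w : List I) (n : ℕ) : cutTensor x γ w n ∈ tensorSpan G x Shuffle w := by
  refine tmul_mem (u := w.take n) (v := w.drop n) ?_
    (wordProd_mul_mem (mem_upper_self _) (hx.prod_mem _)) (wordProd_mem (mem_upper_self _))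
  simpa using shuffle_append (w.take n) (w.drop n)

theorem comul_wordProd_mul_mem (w : List I) {g : GroupLike k H} (hg : g ∈ G) :
    Coalgebra.comul (R := k) (wordProd x w * (g : H)) ∈ tensorSpan G x Shuffle w := by
  have h1 : tensorSpan G x Crossing w ≤ tensorSpan G x Shuffle w :=
    tensorSpan_le fun u v h y hy z hz => tmul_mem h.shuffle hy hz
  have h2 : Coalgebra.comul (R := k) (wordProd x w) ∈ tensorSpan G x Shuffle w := by
    have := add_mem (h1 (hx.comul_wordProd w))
      (Submodule.sum_mem _ fun n (_ : n ∈ Finset.range (w.length + 1)) => hx.cutTensor_mem w n)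
    simpa using this
  have h3 : tensorSpan G x Shuffle w ≤ (tensorSpan G x Shuffle w).comap
      (LinearMap.mulRight k ((g : H) ⊗ₜ[k] (g : H))) :=
    tensorSpan_le fun u v h y hy z hz => by
      simpa using tmul_mem h (mul_mem_wordSpan hy hg) (mul_mem_wordSpan hz hg)
  have := h3 h2
  rw [Bialgebra.comul_mul, g.isGroupLikeElem_val.comul_eq_tmul_self]
  exact this

/-! ### Products of irreducible words -/

/-- Functionals `φ` and `ψ` vanish on the terms below `a` and `b` and are `1` on `a γ_b` and `b`.
Then `(φ ⊗ ψ) ∘ Δ` kills everything below `ab`, but is `1` on `ab`: crossings have a lower factor,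
and a cut other than the one after `a` makes one side too short. -/
theorem not_isReducible_append {a b : List I} (ha : ¬ IsReducible G x a)
    (hb : ¬ IsReducible G x b) (hab : ∀ s, s <:+ a → s ≠ [] → b < s) :
    ¬ IsReducible G x (a ++ b) := by
  intro hred
  obtain ⟨φ, hφ, hφ1⟩ := exists_functional
    (fun h => ha (mem_of_mul_mem (hx.prod_mem b) h) :
      wordProd x a * ((b.map γ).prod : GroupLike k H) ∉ wordSpan G x (below a))
  obtain ⟨ψ, hψ, hψ1⟩ := exists_functional hb
  let θ : H ⊗[k] H →ₗ[k] k := LinearMap.mul' k k ∘ₗ TensorProduct.map φ ψ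
  have hθ : ∀ y z, θ (y ⊗ₜ[k] z) = φ y * ψ z := fun y z => by simp [θ]
  have hker : ∀ {u v : List I}, u ∈ below a ∨ v ∈ below b → ∀ y ∈ wordSpan G x (upper u),
      ∀ z ∈ wordSpan G x (upper v), y ⊗ₜ[k] z ∈ LinearMap.ker θ := by
    intro u v huv y hy z hz
    rw [LinearMap.mem_ker, hθ]
    rcases huv with h | h
    · rw [hφ y (wordSpan_mono (upper_subset_below h) hy), zero_mul]
    · rw [hψ z (wordSpan_mono (upper_subset_below h) hz), mul_zero]
  have h1 : wordSpan G x (below (a ++ b)) ≤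
      (LinearMap.ker θ).comap (Coalgebra.comul (R := k) (A := H)) :=
    wordSpan_le fun w hw g hg =>
      tensorSpan_le (fun u v h => hker (mem_below_or_of_shuffle h hab hw)) (hx.comul_wordProd_mul_mem w hg)
  have h2 : tensorSpan G x Crossing (a ++ b) ≤ LinearMap.ker θ :=
    tensorSpan_le fun u v h => hker (mem_below_or_of_crossing h hab)
  have h3 := h2 (hx.comul_wordProd (a ++ b))
  have h4 : θ (Coalgebra.comul (R := k) (wordProd x (a ++ b))) = 0 := h1 hred
  rw [LinearMap.mem_ker, map_sub, h4, map_sum, zero_sub, neg_eq_zero,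
    Finset.sum_eq_single a.length] at h3
  · simp [cutTensor, hθ, hφ1, hψ1] at h3
  · intro n hn hna
    refine hker (u := (a ++ b).take n) (v := (a ++ b).drop n) ?_ _
      (wordProd_mul_mem (mem_upper_self _) (hx.prod_mem _)) _ (wordProd_mem (mem_upper_self _))
    rw [Finset.mem_range, List.length_append] at hn
    rcases lt_or_gt_of_ne hna with h | h
    · left; left
      rw [List.length_take, List.length_append]
      omega
    · right; left
      rw [List.length_drop, List.length_append]
      omega
  · simp

/-! ### Irreducible words form a basis over the group algebra -/

/-- Only the cut at the end of `w` keeps all letters on the left; it contributes `w g ⊗ g`, and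
every other term has a shorter left factor. -/
theorem rid_lTensor_comul_sub_mem (w : List I) (φ : H →ₗ[k] k) (g : GroupLike k H) (hg : g ∈ G) :
    TensorProduct.rid k H (φ.lTensor H (Coalgebra.comul (R := k) (wordProd x w * (g : H)))) -
      φ g • (wordProd x w * (g : H)) ∈ wordSpan G x {v | v.length < w.length} := by
  let F : H ⊗[k] H →ₗ[k] H := (TensorProduct.rid k H).toLinearMap ∘ₗ φ.lTensor H ∘ₗ
    LinearMap.mulRight k ((g : H) ⊗ₜ[k] (g : H))
  have hF : ∀ y z, F (y ⊗ₜ[k] z) = φ (z * (g : H)) • (y * (g : H)) := fun y z => by simp [F]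
  have h1 : TensorProduct.rid k H (φ.lTensor H (Coalgebra.comul (R := k)
      (wordProd x w * (g : H)))) = F (Coalgebra.comul (R := k) (wordProd x w)) := by
    rw [Bialgebra.comul_mul, g.isGroupLikeElem_val.comul_eq_tmul_self]
    rfl
  have hker : ∀ {u v : List I}, u.length < w.length → ∀ y ∈ wordSpan G x (upper u), ∀ z : H,
      F (y ⊗ₜ[k] z) ∈ wordSpan G x {v | v.length < w.length} := by
    intro u v huv y hy z
    rw [hF]
    refine Submodule.smul_mem _ _ (mul_mem_wordSpan (wordSpan_mono ?_ hy) hg)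
    exact fun v hv => hv.1.trans_lt huv
  have h2 : tensorSpan G x Crossing w ≤ (wordSpan G x {v | v.length < w.length}).comap F :=
    tensorSpan_le fun u v h y hy z _ => hker (v := v) (by
      have := h.shuffle.length_eq
      have := List.length_pos_of_ne_nil h.ne_nil.2
      omega) y hy z
  have h3 : F (Coalgebra.comul (R := k) (wordProd x w)) - φ g • (wordProd x w * (g : H)) =
      F (Coalgebra.comul (R := k) (wordProd x w) -
        ∑ n ∈ Finset.range (w.length + 1), cutTensor x γ w n) +
      ∑ n ∈ Finset.range w.length, F (cutTensor x γ w n) := by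
    have : F (cutTensor x γ w w.length) = φ g • (wordProd x w * (g : H)) := by
      simp [cutTensor, hF, wordProd]
    rw [map_sub, map_sum, Finset.sum_range_succ, this]
    abel
  rw [h1, h3]
  refine add_mem (h2 (hx.comul_wordProd w)) (Submodule.sum_mem _ fun n hn => ?_)
  refine hker (u := w.take n) (v := w.drop n) ?_ _
    (wordProd_mul_mem (mem_upper_self _) (hx.prod_mem _)) _
  rw [Finset.mem_range] at hn
  rw [List.length_take]
  omega

theorem linearIndependent_irreducible :
    LinearIndependent k fun p : {w : List I // ¬ IsReducible G x w} × G =>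
      wordProd x p.1.1 * (p.2.1 : H) := by
  rw [linearIndependent_iff]
  intro l hl
  by_contra hl0
  obtain ⟨⟨w, g₀⟩, hw, hmax⟩ := exists_forall_eq_or_mem_below l.support
    (Finsupp.support_nonempty_iff.2 hl0) fun p => p.1.1
  apply w.2
  -- Distinct group-likes are linearly independent, so some functional separates `g₀` from all the
  -- others.
  have hg₀ : (g₀.1 : H) ∉ Submodule.span k ((GroupLike.val (R := k) (A := H)) '' {g₀.1}ᶜ) :=
    (linearIndep_groupLikeVal (R := k) (A := H)).notMem_span_image (by simp)
  obtain ⟨φ, hφ, hφ1⟩ := exists_functional hg₀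
  let T : H →ₗ[k] H ⧸ wordSpan G x (below w.1) := (wordSpan G x (below w.1)).mkQ ∘ₗ
    (TensorProduct.rid k H).toLinearMap ∘ₗ φ.lTensor H ∘ₗ Coalgebra.comul
  have hT : ∀ p ∈ l.support, T (wordProd x p.1.1 * (p.2.1 : H)) =
      φ p.2.1 • (wordSpan G x (below w.1)).mkQ (wordProd x p.1.1 * (p.2.1 : H)) := by
    intro p hp
    rw [← map_smul, ← sub_eq_zero]
    change (wordSpan G x (below w.1)).mkQ _ - _ = 0
    rw [← map_sub, ← LinearMap.mem_ker, Submodule.ker_mkQ]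
    refine wordSpan_mono ?_ (hx.rid_lTensor_comul_sub_mem p.1.1 φ p.2.1 p.2.2)
    intro v hv
    rcases hmax p hp with h | h
    · exact .inl (h ▸ hv)
    · exact below_subset_below h (.inl hv)
  have h1 := congrArg T hl
  rw [Finsupp.linearCombination_apply, Finsupp.sum, map_sum, map_zero,
    Finset.sum_eq_single (w, g₀)] at h1
  · rw [map_smul, hT _ hw, hφ1, one_smul] at h1
    have h2 := (smul_eq_zero.1 h1).resolve_left (Finsupp.mem_support_iff.1 hw)
    rw [← LinearMap.mem_ker, Submodule.ker_mkQ] at h2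
    exact mem_of_mul_mem g₀.2 h2
  · intro p hp hne
    rw [map_smul, hT p hp]
    by_cases hg : p.2 = g₀
    · have h2 : p.1.1 ∈ below w.1 := by
        refine (hmax p hp).resolve_left fun h => hne ?_
        exact Prod.ext (Subtype.ext h) hg
      have h3 : (wordSpan G x (below w.1)).mkQ (wordProd x p.1.1 * (p.2.1 : H)) = 0 := by
        rw [← LinearMap.mem_ker, Submodule.ker_mkQ]
        exact wordProd_mul_mem h2 p.2.2
      rw [h3, smul_zero, smul_zero]
    · rw [hφ _ (Submodule.subset_span ⟨p.2.1, fun h => hg (Subtype.ext h), rfl⟩), zero_smul,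
        smul_zero]
  · exact fun h => absurd hw h

theorem wordSpan_univ (hgen : Algebra.adjoin k
    ((fun g : GroupLike k H => (g : H)) '' (G : Set (GroupLike k H)) ∪ Set.range x) = ⊤) :
    wordSpan G x Set.univ = ⊤ := by
  have key : ∀ y : H, ∀ z ∈ wordSpan G x Set.univ, y * z ∈ wordSpan G x Set.univ := by
    intro y
    have hy : y ∈ Algebra.adjoin k
      ((fun g : GroupLike k H => (g : H)) '' (G : Set (GroupLike k H)) ∪ Set.range x) := by
      rw [hgen]
      trivial
    induction hy using Algebra.adjoin_induction with
    | mem y hy =>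
      intro z hz
      rcases hy with ⟨g, hg, rfl⟩ | ⟨i, rfl⟩
      · exact hx.groupLike_mul_mem hz hg fun _ _ => Set.subset_univ _
      · exact letter_mul_mem_wordSpan hz i fun _ _ => Set.mem_univ _
    | algebraMap r =>
      intro z hz
      rw [← Algebra.smul_def]
      exact Submodule.smul_mem _ _ hz
    | add y y' _ _ h h' =>
      intro z hz
      rw [add_mul]
      exact add_mem (h z hz) (h' z hz)
    | mul y y' _ _ h h' =>
      intro z hz
      rw [mul_assoc]
      exact h _ (h' z hz)
  refine (Submodule.eq_top_iff').2 fun y => ?_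
  have h1 : (1 : H) ∈ wordSpan G x Set.univ := wordProd_mem (w := []) (Set.mem_univ _)
  simpa using key y 1 h1

end TriangularLetters

end Spans

/-! ### Nonincreasing lists and exponent functions -/

section SortedList

variable {σ : Type*} [LinearOrder σ]

/-- The nonincreasing list in which every `s` occurs `e s` times. -/
def sortedList (e : σ →₀ ℕ) : List σ :=
  (e.support.sort (· ≥ ·)).flatMap fun s => List.replicate (e s) s

theorem pairwise_sortedList (e : σ →₀ ℕ) : (sortedList e).Pairwise (· ≥ ·) := by
  refine List.pairwise_flatMap.2 ⟨fun s _ => by simp [List.pairwise_replicate], ?_⟩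
  refine (Finset.pairwise_sort e.support (· ≥ ·)).imp fun {s t} h x hx y hy => ?_
  rw [List.eq_of_mem_replicate hx, List.eq_of_mem_replicate hy]
  exact h

theorem count_sortedList (e : σ →₀ ℕ) (s : σ) : (sortedList e).count s = e s := by
  rw [sortedList, List.count_flatMap, ← List.sum_toFinset _ (Finset.sort_nodup _ _),
    Finset.sort_toFinset, Finset.sum_eq_single s]
  · simp
  · intro t _ hts
    simp [List.count_replicate, hts]
  · intro hs
    simp [Finsupp.notMem_support_iff.1 hs]

theorem sortedList_injective : Function.Injective (sortedList (σ := σ)) := fun e f h => by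
  ext s
  rw [← count_sortedList, h, count_sortedList]

theorem exists_sortedList_eq {L : List σ} (hL : L.Pairwise (· ≥ ·)) : ∃ e, sortedList e = L := by
  refine ⟨Multiset.toFinsupp (L : Multiset σ), ?_⟩
  refine List.Perm.eq_of_pairwise (fun a b _ _ h h' => le_antisymm h' h)
    (pairwise_sortedList _) hL (List.perm_iff_count.2 fun s => ?_)
  rw [count_sortedList, Multiset.toFinsupp_apply, Multiset.coe_count]

end SortedList

section LyndonBasis

/-! ### The PBW basis attached to triangular letters -/

variable {k : Type*} [Field k] {H : Type*} [Ring H] [HopfAlgebra k H]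
  {I : Type*} [LinearOrder I] {G : Subgroup (GroupLike k H)} {x : I → H} {γ : I → GroupLike k H}

theorem not_isReducible_nil : ¬ IsReducible G x [] := by
  intro h
  have h1 : wordSpan G x (below []) ≤ ⊥ := by
    refine wordSpan_le ?_
    rintro v (hv | ⟨hl, hv⟩)
    · simp at hv
    · exact absurd (List.length_eq_zero_iff.1 hl) (ne_nil_of_lt hv)
  have h2 : (1 : H) = 0 := by simpa [wordProd] using h1 h
  exact (1 : GroupLike k H).isGroupLikeElem_val.ne_zero h2

theorem TriangularLetters.not_isReducible_of_append (hx : TriangularLetters G x γ) {p w q : List I}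
    (h : ¬ IsReducible G x (p ++ w ++ q)) : ¬ IsReducible G x w :=
  fun hw => h (hx.isReducible_append hw p q)

/-- A decreasing product of irreducible powers of Lyndon words is irreducible. -/
theorem TriangularLetters.not_isReducible_flatMap (hx : TriangularLetters G x γ) {σ : Type*} (T : List σ)
    (word : σ → List I) (e : σ → ℕ) (hT : T.Pairwise fun s t => word t < word s)
    (hlyn : ∀ s ∈ T, IsLyndon (word s))
    (h : ∀ s ∈ T, ¬ IsReducible G x (List.replicate (e s) (word s)).flatten) :
    ¬ IsReducible G x (T.flatMap fun s => List.replicate (e s) (word s)).flatten := by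
  induction T with
  | nil => exact not_isReducible_nil
  | cons s T ih =>
    rw [List.pairwise_cons] at hT
    rw [List.flatMap_cons, List.flatten_append]
    refine hx.not_isReducible_append (h s (by simp))
      (ih hT.2 (fun t ht => hlyn t (by simp [ht])) fun t ht => h t (by simp [ht])) ?_
    refine fun r hr hr' => (hlyn s (by simp)).flatten_lt_of_suffix_pow (e s) ?_ hr hr'
    intro m hm
    obtain ⟨t, ht, hm⟩ := List.mem_flatMap.1 hm
    rw [List.eq_of_mem_replicate hm]
    exact hT.1 t ht

/-- This allows irreducible Lyndon words to be replaced by their values in `H`, as `S` must be a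
subset of `H`. -/
theorem TriangularLetters.wordProd_injOn (hx : TriangularLetters G x γ) {v w : List I} (hv : ¬ IsReducible G x v)
    (hw : ¬ IsReducible G x w) (h : wordProd x v = wordProd x w) : v = w := by
  have := hx.linearIndependent_irreducible.injective
    (a₁ := (⟨v, hv⟩, 1)) (a₂ := (⟨w, hw⟩, 1)) (by simpa using h)
  simpa using this

/-- The generators of the PBW basis: the products of the irreducible Lyndon words. -/
def lyndonGenerators (G : Subgroup (GroupLike k H)) (x : I → H) : Set H :=
  {s | ∃ w, IsLyndon w ∧ ¬ IsReducible G x w ∧ wordProd x w = s}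

/-- The irreducible Lyndon word that gives a generator. -/
def lyndonWord (s : lyndonGenerators G x) : List I := s.2.choose

theorem isLyndon_lyndonWord (s : lyndonGenerators G x) : IsLyndon (lyndonWord s) :=
  s.2.choose_spec.1

theorem not_isReducible_lyndonWord (s : lyndonGenerators G x) :
    ¬ IsReducible G x (lyndonWord s) :=
  s.2.choose_spec.2.1

theorem wordProd_lyndonWord (s : lyndonGenerators G x) : wordProd x (lyndonWord s) = s :=
  s.2.choose_spec.2.2

theorem lyndonWord_injective : Function.Injective (lyndonWord (G := G) (x := x)) :=
  fun s t h => Subtype.ext (by rw [← wordProd_lyndonWord, h, wordProd_lyndonWord])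

/-- The generators are ordered as the Lyndon words that give them. -/
instance lyndonGeneratorsLinearOrder : LinearOrder (lyndonGenerators G x) :=
  LinearOrder.lift' lyndonWord lyndonWord_injective

/-- The least `n` for which the `n`-th power of the Lyndon word is reducible, or `∞`. -/
def lyndonHeight (s : lyndonGenerators G x) : ℕ∞ :=
  ⨅ n ∈ {n : ℕ | IsReducible G x (List.replicate n (lyndonWord s)).flatten}, (n : ℕ∞)

/-- Reducibility of a power passes to all higher powers, since these contain it as a factor. -/
theorem TriangularLetters.lt_lyndonHeight (hx : TriangularLetters G x γ) (s : lyndonGenerators G x) (n : ℕ) :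
    (n : ℕ∞) < lyndonHeight s ↔ ¬ IsReducible G x (List.replicate n (lyndonWord s)).flatten := by
  constructor
  · exact fun h hn => absurd (h.trans_le (iInf₂_le n hn)) (lt_irrefl _)
  · intro h
    have h1 : ((n + 1 : ℕ) : ℕ∞) ≤ lyndonHeight s := by
      refine le_iInf₂ fun m hm => ?_
      rw [Nat.cast_le]
      by_contra! hmn
      have hm' : n = m + (n - m) := by omega
      rw [hm', List.replicate_add, List.flatten_append] at h
      exact hx.not_isReducible_of_append (p := []) h hm
    refine lt_of_lt_of_le ?_ h1
    exact_mod_cast Nat.lt_succ_self n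

/-- The word of an ordered monomial. -/
def monomialWord (e : lyndonGenerators G x →₀ ℕ) : List I :=
  ((sortedList e).map lyndonWord).flatten

theorem monomialWord_eq (e : lyndonGenerators G x →₀ ℕ) : monomialWord e =
    ((e.support.sort (· ≥ ·)).flatMap fun s => List.replicate (e s) (lyndonWord s)).flatten := by
  simp [monomialWord, sortedList, List.map_flatMap]

theorem wordProd_monomialWord (e : lyndonGenerators G x →₀ ℕ) :
    wordProd x (monomialWord e) = monomial (lyndonGenerators G x) e := by
  rw [monomialWord_eq, monomial]
  induction e.support.sort (· ≥ ·) with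
  | nil => simp [wordProd]
  | cons s T ih =>
    rw [List.flatMap_cons, List.flatten_append, wordProd_append, ih, List.map_cons,
      List.prod_cons, wordProd_flatten, List.map_replicate, List.prod_replicate,
      wordProd_lyndonWord]

theorem TriangularLetters.not_isReducible_monomialWord (hx : TriangularLetters G x γ)
    (e : Exponents (lyndonGenerators G x) lyndonHeight) :
    ¬ IsReducible G x (monomialWord e.1) := by
  rw [monomialWord_eq]
  refine hx.not_isReducible_flatMap _ _ _ ?_ (fun s _ => isLyndon_lyndonWord s) fun s hs => ?_
  · exact (Finset.sortedGT_sort e.1.support).pairwise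
  · exact (hx.lt_lyndonHeight s _).1 (e.2 s (by simpa using hs))

theorem monomialWord_injective :
    Function.Injective (monomialWord (G := G) (x := x)) := by
  intro e f h
  have key : ∀ e : lyndonGenerators G x →₀ ℕ,
      (∀ l ∈ (sortedList e).map lyndonWord, IsLyndon l) ∧
      ((sortedList e).map lyndonWord).Pairwise (· ≥ ·) := fun e =>
    ⟨fun l hl => by
      obtain ⟨s, -, rfl⟩ := List.mem_map.1 hl
      exact isLyndon_lyndonWord s,
      List.pairwise_map.2 (pairwise_sortedList e)⟩
  have h1 := lyndon_factorization_unique (key e).1 (key e).2 (key f).1 (key f).2 h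
  exact sortedList_injective (lyndonWord_injective.list_map h1)

theorem TriangularLetters.exists_monomialWord_eq (hx : TriangularLetters G x γ) {w : List I}
    (hw : ¬ IsReducible G x w) :
    ∃ e : Exponents (lyndonGenerators G x) lyndonHeight, monomialWord e.1 = w := by
  obtain ⟨L, h1, h2, rfl⟩ := exists_lyndon_factorization w
  have h3 : L ∈ Set.range (List.map (lyndonWord (G := G) (x := x))) := by
    rw [Set.range_list_map]
    intro l hl
    obtain ⟨p, q, rfl⟩ := List.append_of_mem hl
    have hl' : ¬ IsReducible G x l := by
      rw [List.flatten_append, List.flatten_cons, ← List.append_assoc] at hw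
      exact hx.not_isReducible_of_append hw
    let s : lyndonGenerators G x := ⟨wordProd x l, l, h1 l hl, hl', rfl⟩
    -- The word chosen for `s` is `l`, because both are irreducible with the same product.
    exact ⟨s, hx.wordProd_injOn (not_isReducible_lyndonWord s) hl' (wordProd_lyndonWord s)⟩
  obtain ⟨M, rfl⟩ := h3
  obtain ⟨e, rfl⟩ := exists_sortedList_eq (L := M)
    ((List.pairwise_map (f := lyndonWord)).1 h2)
  refine ⟨⟨e, fun s hs => (hx.lt_lyndonHeight s _).2 fun hred => ?_⟩, rfl⟩
  have hs' : s ∈ e.support.sort (· ≥ ·) := by simpa using hs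
  obtain ⟨p, q, hpq⟩ := List.append_of_mem hs'
  change ¬ IsReducible G x (monomialWord e) at hw
  rw [monomialWord_eq, hpq, List.flatMap_append, List.flatMap_cons, List.flatten_append,
    List.flatten_append, ← List.append_assoc] at hw
  exact hx.not_isReducible_of_append hw hred

theorem TriangularLetters.isPBWBasis [Finite I] (hx : TriangularLetters G x γ) (hgen : Algebra.adjoin k
    ((fun g : GroupLike k H => (g : H)) '' (G : Set (GroupLike k H)) ∪ Set.range x) = ⊤) :
    IsPBWBasis (lyndonGenerators G x) k
      ((fun g : GroupLike k H => (g : H)) '' (G : Set (GroupLike k H))) lyndonHeight := by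
  have hρ : ∀ p : ((fun g : GroupLike k H => (g : H)) '' (G : Set (GroupLike k H)) : Set H),
      ∃ g : G, (g.1 : H) = p := by
    rintro ⟨_, g, hg, rfl⟩
    exact ⟨⟨g, hg⟩, rfl⟩
  choose ρ hρ using hρ
  have hprod : ∀ b, product (lyndonGenerators G x)
      ((fun g : GroupLike k H => (g : H)) '' (G : Set (GroupLike k H))) lyndonHeight b =
      wordProd x (monomialWord b.1.1) * ((ρ b.2).1 : H) := by
    intro b
    rw [product, hρ, wordProd_monomialWord]
  have hind : LinearIndependent k (product (lyndonGenerators G x)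
      ((fun g : GroupLike k H => (g : H)) '' (G : Set (GroupLike k H))) lyndonHeight) := by
    have h := hx.linearIndependent_irreducible.comp
      (fun b : Exponents (lyndonGenerators G x) lyndonHeight ×
          ((fun g : GroupLike k H => (g : H)) '' (G : Set (GroupLike k H)) : Set H) =>
        (⟨monomialWord b.1.1, hx.not_isReducible_monomialWord b.1⟩, ρ b.2)) (by
      rintro ⟨e, p⟩ ⟨f, q⟩ h
      rw [Prod.mk.injEq, Subtype.mk.injEq] at h
      refine Prod.ext (Subtype.ext (monomialWord_injective h.1)) (Subtype.ext ?_)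
      rw [← hρ, h.2, hρ])
    convert h using 1
    exact funext hprod
  refine ⟨fun s => ?_, hind.injective, hind.linearIndepOn_id, ?_⟩
  · exact_mod_cast (hx.lt_lyndonHeight s 0).2 not_isReducible_nil
  · refine top_le_iff.1 (wordSpan_irreducible (hx.wordSpan_univ hgen) ▸ wordSpan_le ?_)
    intro w hw g hg
    obtain ⟨e, rfl⟩ := hx.exists_monomialWord_eq hw
    refine Submodule.subset_span ⟨(e, ⟨g, g, hg, rfl⟩), ?_⟩
    rw [product, wordProd_monomialWord]

end LyndonBasis

/-! ### Simultaneous triangularization -/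

section Triangularization

variable {k : Type*} [Field k] [IsAlgClosed k] {ι : Type*}

/-- If some `f i` is not scalar, it has a proper nonzero eigenspace, which all the commuting maps
preserve. -/
theorem exists_common_eigenvector (n : ℕ) : ∀ {V : Type*} [AddCommGroup V] [Module k V]
    [FiniteDimensional k V] [Nontrivial V] (f : ι → Module.End k V)
    (_ : ∀ i j, Commute (f i) (f j)) (_ : Module.finrank k V = n),
    ∃ v, v ≠ 0 ∧ ∀ i, ∃ c : k, f i v = c • v := by
  induction n using Nat.strong_induction_on with
  | _ n ih =>
    intro V _ _ _ _ f hf hn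
    by_cases hs : ∀ i, ∃ c : k, ∀ v, f i v = c • v
    · obtain ⟨v, hv⟩ := exists_ne (0 : V)
      exact ⟨v, hv, fun i => (hs i).imp fun c hc => hc v⟩
    · push Not at hs
      obtain ⟨i, hi⟩ := hs
      obtain ⟨c, hc⟩ := Module.End.exists_eigenvalue (f i)
      let E := Module.End.eigenspace (f i) c
      have hE : ∀ j, ∀ v ∈ E, f j v ∈ E := by
        intro j v hv
        rw [Module.End.mem_eigenspace_iff] at hv ⊢
        have h1 : f i (f j v) = f j (f i v) := LinearMap.congr_fun (hf i j).eq v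
        rw [h1, hv, map_smul]
      have hlt : Module.finrank k E < n := by
        rw [← hn]
        refine Submodule.finrank_lt fun htop => ?_
        obtain ⟨v, hv⟩ := hi c
        have : v ∈ E := by
          rw [htop]
          trivial
        exact hv (Module.End.mem_eigenspace_iff.1 this)
      have : Nontrivial E := Submodule.nontrivial_iff_ne_bot.2 hc
      obtain ⟨v, hv, h⟩ := ih _ hlt (V := E) (fun j => (f j).restrict (hE j))
        (fun j l => by
          ext v
          exact LinearMap.congr_fun (hf j l).eq v.1) rfl
      refine ⟨v.1, fun h0 => hv (Subtype.ext h0), fun j => ?_⟩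
      obtain ⟨b, hb⟩ := h j
      exact ⟨b, congrArg Subtype.val hb⟩

/-- Commuting endomorphisms of a finite-dimensional space are simultaneously triangular with
respect to a suitable finite generating family. -/
theorem exists_triangular_family (n : ℕ) : ∀ {V : Type*} [AddCommGroup V] [Module k V]
    [FiniteDimensional k V] (f : ι → Module.End k V)
    (_ : ∀ i j, Commute (f i) (f j)) (_ : Module.finrank k V = n),
    ∃ (d : ℕ) (y : Fin d → V), Submodule.span k (Set.range y) = ⊤ ∧
      ∀ i j, f i (y j) ∈ Submodule.span k (y '' Set.Ici j) := by
  induction n with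
  | zero =>
    intro V _ _ _ f _ hn
    have := Module.finrank_zero_iff.1 hn
    exact ⟨0, Fin.elim0, Subsingleton.elim _ _, fun _ j => j.elim0⟩
  | succ n ih =>
    intro V _ _ _ f hf hn
    have : Nontrivial V := Module.finrank_pos_iff.1 (by omega : 0 < Module.finrank k V)
    obtain ⟨v, hv, hfv⟩ := exists_common_eigenvector _ f hf rfl
    let Q := Submodule.span k {v}
    have hQ : ∀ i, Q ≤ Q.comap (f i) := by
      intro i
      refine (Submodule.span_singleton_le_iff_mem _ _).2 ?_
      obtain ⟨c, hc⟩ := hfv i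
      rw [Submodule.mem_comap, hc]
      exact Submodule.smul_mem _ _ (Submodule.mem_span_singleton_self v)
    have hdim : Module.finrank k (V ⧸ Q) = n := by
      have h1 := Q.finrank_quotient_add_finrank
      have h2 : Module.finrank k Q = 1 := finrank_span_singleton hv
      omega
    obtain ⟨d, y', h1, h2⟩ := ih (fun i => Q.mapQ Q (f i) (hQ i)) (fun i j => by
      ext u
      exact congrArg Q.mkQ (LinearMap.congr_fun (hf i j).eq u)) hdim
    choose y hy using fun j => Q.mkQ_surjective (y' j)
    have hlift : ∀ (s : Set (Fin d)) (u : V), Q.mkQ u ∈ Submodule.span k (y' '' s) →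
        u ∈ Submodule.span k (y '' s) ⊔ Q := by
      intro s u hu
      have hs : y' '' s = Q.mkQ '' (y '' s) := by
        rw [Set.image_image]
        exact Set.image_congr fun j _ => (hy j).symm
      rw [hs, ← Submodule.map_span, ← Submodule.mem_comap, Submodule.comap_map_eq,
        Submodule.ker_mkQ] at hu
      exact hu
    -- The common eigenvector comes last, so that every span over `Set.Ici j` contains the line `Q`
    -- lost in the quotient.
    let z : Fin (d + 1) → V := Fin.snoc y v
    have hzc : ∀ j : Fin d, z j.castSucc = y j := fun j => Fin.snoc_castSucc (α := fun _ => V) _ _ j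
    have hzl : z (Fin.last d) = v := Fin.snoc_last (α := fun _ => V) _ _
    have hvz : ∀ j, Q ≤ Submodule.span k (z '' Set.Ici j) := fun j =>
      (Submodule.span_singleton_le_iff_mem _ _).2
        (Submodule.subset_span ⟨Fin.last d, Fin.le_last j, hzl⟩)
    refine ⟨d + 1, z, ?_, fun i j => ?_⟩
    · refine (Submodule.eq_top_iff').2 fun u => ?_
      have hu : Q.mkQ u ∈ Submodule.span k (y' '' Set.univ) := by
        rw [Set.image_univ, h1]
        trivial
      refine SetLike.le_def.1 (sup_le ?_ ?_) (hlift _ u hu)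
      · refine Submodule.span_mono ?_
        rintro _ ⟨j, -, rfl⟩
        exact ⟨j.castSucc, hzc j⟩
      · exact (hvz 0).trans (Submodule.span_mono (Set.image_subset_range _ _))
    · induction j using Fin.lastCases with
      | last =>
        rw [hzl]
        exact hvz _ (hQ i (Submodule.mem_span_singleton_self v))
      | cast j =>
        rw [hzc]
        have hu : Q.mkQ (f i (y j)) ∈ Submodule.span k (y' '' Set.Ici j) := by
          have := h2 i j
          rwa [← hy] at this
        refine SetLike.le_def.1 (sup_le ?_ (hvz _)) (hlift _ _ hu)
        refine Submodule.span_mono ?_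
        rintro _ ⟨l, hl, rfl⟩
        exact ⟨l.castSucc, Fin.castSucc_le_castSucc_iff.2 hl, hzc l⟩

end Triangularization

/-! ### The adjoint action of group-like elements -/

section Adjoint

variable {k : Type*} [Field k] {H : Type*} [Ring H] [HopfAlgebra k H]

theorem groupLike_inv_mul (g : GroupLike k H) : ((g⁻¹ : GroupLike k H) : H) * (g : H) = 1 := by
  rw [← GroupLike.val_mul, inv_mul_cancel, GroupLike.val_one]

/-- The adjoint action of a group-like element as a linear map. -/
def adjointMap (g : GroupLike k H) : H →ₗ[k] H :=
  LinearMap.mulRight k ((g⁻¹ : GroupLike k H) : H) ∘ₗ LinearMap.mulLeft k (g : H)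

theorem adjointMap_apply (g : GroupLike k H) (y : H) : adjointMap g y = adjointAction g y := rfl

theorem adjointAction_mul (g h : GroupLike k H) (y : H) :
    adjointAction (g * h) y = adjointAction g (adjointAction h y) := by
  simp only [adjointAction, mul_inv_rev, GroupLike.val_mul, mul_assoc]

theorem adjointAction_one (y : H) : adjointAction (1 : GroupLike k H) y = y := by
  rw [adjointAction, inv_one, GroupLike.val_one, one_mul, mul_one]

theorem groupLike_mul_eq (g : GroupLike k H) (y : H) :
    (g : H) * y = adjointAction g y * (g : H) := by
  rw [adjointAction, mul_assoc, groupLike_inv_mul, mul_one]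

theorem groupLike_mul_mul {c g : GroupLike k H} (h : c * g = g * c) (y : H) :
    (c : H) * (y * (g : H)) = adjointAction c y * ((g : H) * (c : H)) := by
  rw [← mul_assoc, groupLike_mul_eq, mul_assoc, ← GroupLike.val_mul, h, GroupLike.val_mul]

/-- The skew-primitive elements for a given pair of group-like elements. -/
def skewPrimitives (g h : GroupLike k H) : Submodule k H :=
  LinearMap.eqLocus (Coalgebra.comul (R := k) (A := H))
    (TensorProduct.mk k H H (g : H) + (TensorProduct.mk k H H).flip (h : H))

theorem mem_skewPrimitives {g h : GroupLike k H} {y : H} :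
    y ∈ skewPrimitives g h ↔ IsSkewPrimitive k g h y := Iff.rfl

theorem IsSkewPrimitive.mul_groupLike {g h : GroupLike k H} {y : H}
    (hy : IsSkewPrimitive k g h y) (c : GroupLike k H) :
    IsSkewPrimitive k (g * c) (h * c) (y * (c : H)) := by
  rw [IsSkewPrimitive, Bialgebra.comul_mul, hy, c.isGroupLikeElem_val.comul_eq_tmul_self, add_mul,
    Algebra.TensorProduct.tmul_mul_tmul, Algebra.TensorProduct.tmul_mul_tmul, GroupLike.val_mul,
    GroupLike.val_mul]

theorem IsSkewPrimitive.groupLike_mul {g h : GroupLike k H} {y : H}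
    (hy : IsSkewPrimitive k g h y) (c : GroupLike k H) :
    IsSkewPrimitive k (c * g) (c * h) ((c : H) * y) := by
  rw [IsSkewPrimitive, Bialgebra.comul_mul, hy, c.isGroupLikeElem_val.comul_eq_tmul_self, mul_add,
    Algebra.TensorProduct.tmul_mul_tmul, Algebra.TensorProduct.tmul_mul_tmul, GroupLike.val_mul,
    GroupLike.val_mul]

theorem IsSkewPrimitive.adjointAction {g h c : GroupLike k H} {y : H}
    (hy : IsSkewPrimitive k g h y) (hg : c * g = g * c) (hh : c * h = h * c) :
    IsSkewPrimitive k g h (adjointAction c y) := by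
  have := (hy.groupLike_mul c).mul_groupLike c⁻¹
  rwa [hg, hh, mul_inv_cancel_right, mul_inv_cancel_right] at this

/-- A skew-primitive element whose conjugates span a finite-dimensional space lies in the span of
a finite family of skew-primitive elements on which the conjugation is triangular. -/
theorem exists_triangular_skewPrimitives [IsAlgClosed k] (G : Subgroup (GroupLike k H))
    (hG : ∀ x ∈ G, ∀ y ∈ G, x * y = y * x) {g h : GroupLike k H} (hg : g ∈ G) (hh : h ∈ G) {a : H}
    (ha : IsSkewPrimitive k g h a) (N : Submodule k H) [FiniteDimensional k N]
    (hN : ∀ c ∈ G, PBW.adjointAction c a ∈ N) :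
    ∃ (d : ℕ) (y : Fin d → H), a ∈ Submodule.span k (Set.range y) ∧
      (∀ j, IsSkewPrimitive k g h (y j)) ∧
      ∀ c ∈ G, ∀ j, PBW.adjointAction c (y j) ∈ Submodule.span k (y '' Set.Ici j) := by
  let W : Submodule k H := Submodule.span k {z | ∃ c ∈ G, z = PBW.adjointAction c a}
  have hWN : W ≤ N := Submodule.span_le.2 (by
    rintro _ ⟨c, hc, rfl⟩
    exact hN c hc)
  -- As `G` is commutative, conjugation by `c` fixes `g` and `h`, so the whole orbit has the same
  -- type `(g, h)`.
  have hWs : W ≤ skewPrimitives g h := Submodule.span_le.2 (by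
    rintro _ ⟨c, hc, rfl⟩
    exact mem_skewPrimitives.2 (ha.adjointAction (hG c hc g hg) (hG c hc h hh)))
  have hWc : ∀ c : G, ∀ z ∈ W, adjointMap c.1 z ∈ W := by
    intro c
    change W ≤ W.comap (adjointMap c.1)
    refine Submodule.span_le.2 ?_
    rintro _ ⟨b, hb, rfl⟩
    refine Submodule.subset_span ⟨c.1 * b, G.mul_mem c.2 hb, ?_⟩
    rw [adjointMap_apply, adjointAction_mul]
  have : FiniteDimensional k W := Submodule.finiteDimensional_of_le hWN
  obtain ⟨d, y, h1, h2⟩ := exists_triangular_family _ (fun c : G => (adjointMap c.1).restrict (hWc c))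
    (fun b c => by
      ext z
      change PBW.adjointAction b.1 (PBW.adjointAction c.1 z.1) =
        PBW.adjointAction c.1 (PBW.adjointAction b.1 z.1)
      rw [← adjointAction_mul, ← adjointAction_mul, hG _ b.2 _ c.2]) rfl
  refine ⟨d, fun j => (y j : H), ?_, fun j => mem_skewPrimitives.1 (hWs (y j).2), ?_⟩
  · have h3 : a ∈ W := Submodule.subset_span ⟨1, G.one_mem, (adjointAction_one a).symm⟩
    have h4 : (⟨a, h3⟩ : W) ∈ Submodule.span k (Set.range y) := by
      rw [h1]
      trivial
    have h5 := Submodule.mem_map_of_mem (f := W.subtype) h4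
    rwa [Submodule.map_span, ← Set.range_comp] at h5
  · intro c hc j
    have h5 := Submodule.mem_map_of_mem (f := W.subtype) (h2 ⟨c, hc⟩ j)
    rwa [Submodule.map_span, Set.image_image] at h5

end Adjoint

end PBW

end

/-! ### Reduction of the theorem to triangular letters -/

theorem mainTheorem5 {k : Type*} [Field k] [IsAlgClosed k] {H : Type*} [Ring H] [HopfAlgebra k H]
    (G : Subgroup (GroupLike k H)) (hG : ∀ x ∈ G, ∀ y ∈ G, x * y = y * x)
    (t : ℕ) (a : Fin t → H)
    (ha : ∀ i, ∃ g ∈ G, ∃ h ∈ G, PBW.IsSkewPrimitive k g h (a i))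
    (hstable : ∀ g ∈ G, ∀ x ∈ Submodule.span k (Set.range a),
      PBW.adjointAction g x ∈ Submodule.span k (Set.range a))
    (hgen : Algebra.adjoin k ((fun g : GroupLike k H => (g : H)) '' (G : Set (GroupLike k H)) ∪
      Set.range a) = ⊤) :
    ∃ (S : Set H) (_ : LinearOrder S) (h : S → ℕ∞),
      PBW.IsPBWBasis S k ((fun g : GroupLike k H => (g : H)) '' (G : Set (GroupLike k H))) h := by
  choose g hg h hh ha using ha
  have : FiniteDimensional k (Submodule.span k (Set.range a)) :=
    FiniteDimensional.span_of_finite k (Set.finite_range a)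
  -- Each `a i` gets its own block of letters, since its type `(g i, h i)` may differ from the
  -- others. Linear dependences between letters do no harm: they only make some letters reducible.
  choose d y hay hy hyG using fun i => PBW.exists_triangular_skewPrimitives G hG (hg i) (hh i)
    (ha i) (Submodule.span k (Set.range a))
    fun c hc => hstable c hc _ (Submodule.subset_span ⟨i, rfl⟩)
  -- Multiplying by `(h i)⁻¹` makes the right group-like trivial. In the lexicographic order on
  -- pairs, triangularity within each block suffices.
  let x : (Σₗ i, Fin (d i)) → H := fun p => y p.1 p.2 * (((h p.1)⁻¹ : GroupLike k H) : H)
  let γ : (Σₗ i, Fin (d i)) → GroupLike k H := fun p => g p.1 * (h p.1)⁻¹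
  have : Finite (Σₗ i, Fin (d i)) := inferInstanceAs (Finite (Σ i, Fin (d i)))
  have hx : PBW.TriangularLetters G x γ := by
    refine ⟨fun p => G.mul_mem (hg _) (G.inv_mem (hh _)), fun p => ?_, fun c hc p => ?_⟩
    · have h1 := (hy p.1 p.2).mul_groupLike (h p.1)⁻¹
      rw [PBW.IsSkewPrimitive, mul_inv_cancel, GroupLike.val_one] at h1
      rw [add_comm]
      exact h1
    · have h1 : Submodule.span k (y p.1 '' Set.Ici p.2) ≤
          (Submodule.span k {z : H | ∃ q, p ≤ q ∧ z = x q * (c : H)}).comap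
            (LinearMap.mulRight k ((((h p.1)⁻¹ : GroupLike k H) : H) * (c : H))) := by
        refine Submodule.span_le.2 ?_
        rintro _ ⟨j, hj, rfl⟩
        refine Submodule.subset_span ⟨⟨p.1, j⟩, Sigma.Lex.right _ _ hj, ?_⟩
        rw [LinearMap.mulRight_apply, ← mul_assoc]
      have h2 := h1 (hyG p.1 c hc p.2)
      have h3 : (c : H) * x p = PBW.adjointAction c (y p.1 p.2) *
          ((((h p.1)⁻¹ : GroupLike k H) : H) * (c : H)) :=
        PBW.groupLike_mul_mul (hG c hc _ (G.inv_mem (hh p.1))) _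
      rw [h3]
      exact h2
  refine ⟨PBW.lyndonGenerators G x, inferInstance, PBW.lyndonHeight, hx.isPBWBasis ?_⟩
  rw [← top_le_iff, ← hgen]
  refine Algebra.adjoin_le ?_
  set A := Algebra.adjoin k
    ((fun g : GroupLike k H => (g : H)) '' (G : Set (GroupLike k H)) ∪ Set.range x)
  have hGA : ∀ c ∈ G, (c : H) ∈ A := fun c hc => Algebra.subset_adjoin (.inl ⟨c, hc, rfl⟩)
  rintro _ (⟨c, hc, rfl⟩ | ⟨i, rfl⟩)
  · exact hGA c hc
  · have h1 : Submodule.span k (Set.range (y i)) ≤ Subalgebra.toSubmodule A := by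
      refine Submodule.span_le.2 ?_
      rintro _ ⟨j, rfl⟩
      have h2 : x ⟨i, j⟩ * (h i : H) = y i j := by
        change y i j * (((h i)⁻¹ : GroupLike k H) : H) * (h i : H) = y i j
        rw [mul_assoc, PBW.groupLike_inv_mul, mul_one]
      rw [← h2]
      exact A.mul_mem (Algebra.subset_adjoin (.inr ⟨_, rfl⟩)) (hGA _ (hh i))
    exact h1 (hay i)
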